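/- Let $(\Omega,\mathcal F,\mathsf P)$ be a probability space, $L^0=L^0(\mathsf P)$ the space of (classes of) real random variables, $L^\infty=L^\infty(\mathsf P)$, and $\mathcal P$ the set of probability measures absolutely continuous with respect to $\mathsf P$. For $\mathsf Q\in\mathcal P$ and $X\in L^0$ put $\mathsf E_{\mathsf Q}X=\mathsf E_{\mathsf Q}X^+-\mathsf E_{\mathsf Q}X^-\in[-\infty,\infty]$ with the convention $\infty-\infty=-\infty$. A coherent utility function on a set $S\subseteq L^0$ (here $S=L^0$ or $S=L^\infty$) is a map of the form $u(X)=\inf_{\mathsf Q\in\mathcal D}\mathsf E_{\mathsf Q}X$, $X\in S$, with a nonempty $\mathcal D\subseteq\mathcal P$; the largest such $\mathcal D$ is its determining set. It is called weakly compact if the set of densities $d\mathsf Q/d\mathsf P$, $\mathsf Q\in\mathcal D$, is compact in the weak topology of $L^1(\mathsf P)$. For $\mathcal D\subseteq\mathcal P$ and $A\subseteq L^0$ let $$L^1_s(\mathcal D)=\Bigl\{X\in L^0:\lim_{n\to\infty}\sup_{\mathsf Q\in\mathcal D}\mathsf E_{\mathsf Q}|X|I(|X|>n)=0\Bigr\},\qquad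 \mathcal R(A)=\{\mathsf Q\in\mathcal P:\mathsf E_{\mathsf Q}X\le 0\text{ for all }X\in A\}$$ (so that $L^1_s(\emptyset)=L^0$), and call $A$ $\mathcal D$-consistent if there is $A'\subseteq A\cap L^1_s(\mathcal D)$ with $\mathcal D\cap\mathcal R(A)=\mathcal D\cap\mathcal R(A')$. Let $N\ge1$, let $u_1,\dots,u_N$ be coherent utility functions on $L^0$ with weakly compact determining sets $\mathcal D_1,\dots,\mathcal D_N$, let $A_1,\dots,A_N\subseteq L^0$ be convex cones containing $0$ such that $A_n$ is $\mathcal D_n$-consistent for each $n$, and let $W_n\in L^1_s(\mathcal D_n)$, $n=1,\dots,N$. Put $\mathcal D=\bigcap_n\mathcal D_n$ and let $$M=\sup\Bigl\{\sum_{n=1}^N u_n(W_n+X_n+Y_n):\ X_n\in A_n,\ Y_n\in L^1_s(\mathcal D),\ \sum_{n=1}^N Y_n=0\Bigr\}$$ be the maximal overall utility, where a sum is understood as $-\infty$ if any of its summands equals $-\infty$. Then $$M=\inf_{\mathsf Q\in\bigcap_n(\mathcal D_n\cap\mathcal R(A_n))}\mathsf E_{\mathsf Q}\Bigl(\sum_{n=1}^N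 W_n\Bigr),\qquad \inf\emptyset:=\infty.$$ Moreover, the sup-convolution $$v(X)=\sup\Bigl\{\sum_{n=1}^N u_n(X_n):\ X_n\in L^\infty,\ \sum_{n=1}^N X_n=X\Bigr\},\qquad X\in L^\infty,$$ satisfies $v(X)=\inf_{\mathsf Q\in\mathcal D}\mathsf E_{\mathsf Q}X$ for every $X\in L^\infty$ (with $\inf\emptyset:=\infty$). If $\mathcal D\neq\emptyset$, then $v$ is a coherent utility function on $L^\infty$ with determining set $\mathcal D$; if $\mathcal D=\emptyset$, then $v\equiv+\infty$. -/

import Mathlib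

open MeasureTheory Set Filter Topology
open scoped ENNReal

namespace CoherentUtility

noncomputable section

/-- The set of all probability measures `Q` that are absolutely continuous with respect to `P`. -/
abbrev AbsContProb {Ω : Type*} [MeasurableSpace Ω] (P : Measure Ω) : Type _ :=
  {Q : ProbabilityMeasure Ω // (Q : Measure Ω) ≪ P}

/-- The expectation `E_Q X = E_Q X⁺ - E_Q X⁻ ∈ [-∞, ∞]` of a random variable `X ∈ L⁰(P)`, with the
convention `∞ - ∞ = -∞` (which is the convention of the subtraction of `EReal`). It does not depend
on the representative of `X`, because `Q ≪ P`. -/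
def expect {Ω : Type*} [MeasurableSpace Ω] {P : Measure Ω} (Q : AbsContProb P) (X : Ω →ₘ[P] ℝ) :
    EReal :=
  ((∫⁻ ω, ENNReal.ofReal (X ω) ∂(Q.1 : Measure Ω) : ℝ≥0∞) : EReal) -
    ((∫⁻ ω, ENNReal.ofReal (-X ω) ∂(Q.1 : Measure Ω) : ℝ≥0∞) : EReal)

/-- The density `dQ/dP` as an element of `L¹(P)`. -/
def density {Ω : Type*} [MeasurableSpace Ω] {P : Measure Ω} (Q : AbsContProb P) : Ω →₁[P] ℝ :=
  (Measure.integrable_toReal_rnDeriv (μ := (Q.1 : Measure Ω)) (ν := P)).toL1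
    (fun ω => ((Q.1 : Measure Ω).rnDeriv P ω).toReal)

/-- A set of measures `Q ≪ P` is weakly compact if the set of their densities is compact in the weak
topology of the Banach space `L¹(P)`. -/
def IsWeaklyCompact {Ω : Type*} [MeasurableSpace Ω] {P : Measure Ω} (D : Set (AbsContProb P)) :
    Prop :=
  IsCompact (toWeakSpace ℝ (Ω →₁[P] ℝ) '' (density '' D))

/-- The space `L^∞(P)` as a subset of `L⁰(P)`. -/
def Linfty {Ω : Type*} [MeasurableSpace Ω] (P : Measure Ω) : Set (Ω →ₘ[P] ℝ) :=
  (Lp ℝ ∞ P : Set (Ω →ₘ[P] ℝ))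

/-- `u` is, on the set `S` of random variables, a coherent utility function with the determining set
`D`: there is a nonempty set of measures that represents `u` as the infimum of the expectations over
this set, and `D` is the largest one. -/
def IsCoherentUtilityOn {Ω : Type*} [MeasurableSpace Ω] {P : Measure Ω} (S : Set (Ω →ₘ[P] ℝ))
    (u : (Ω →ₘ[P] ℝ) → EReal) (D : Set (AbsContProb P)) : Prop :=
  IsGreatest {D' : Set (AbsContProb P) | D'.Nonempty ∧ ∀ X ∈ S, u X = ⨅ Q ∈ D', expect Q X} D

/-- The strong `L¹`-space of `D`: all `X ∈ L⁰` with `sup_{Q ∈ D} E_Q |X| I(|X| > n) → 0`. -/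
def strongL1 {Ω : Type*} [MeasurableSpace Ω] {P : Measure Ω} (D : Set (AbsContProb P)) :
    Set (Ω →ₘ[P] ℝ) :=
  {X | Tendsto
    (fun n : ℕ => ⨆ Q ∈ D, ∫⁻ ω in {ω | (n : ℝ) < |X ω|}, ENNReal.ofReal |X ω| ∂(Q.1 : Measure Ω))
    atTop (𝓝 0)}

/-- The set of risk-neutral measures: all `Q ≪ P` with `E_Q X ≤ 0` for every `X ∈ A`. -/
def riskNeutral {Ω : Type*} [MeasurableSpace Ω] {P : Measure Ω} (A : Set (Ω →ₘ[P] ℝ)) :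
    Set (AbsContProb P) :=
  {Q | ∀ X ∈ A, expect Q X ≤ 0}

/-- `A` is `D`-consistent: some subset of `A ∩ L¹_s(D)` has the same risk-neutral measures in `D`
as `A`. -/
def IsConsistent {Ω : Type*} [MeasurableSpace Ω] {P : Measure Ω} (D : Set (AbsContProb P))
    (A : Set (Ω →ₘ[P] ℝ)) : Prop :=
  ∃ A' ⊆ A ∩ strongL1 D, D ∩ riskNeutral A = D ∩ riskNeutral A'

/-- The maximal overall utility: the supremum of `∑ uₙ(Wₙ + Xₙ + Yₙ)` over `Xₙ ∈ Aₙ` and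
`Yₙ ∈ L¹_s(⋂ₙ Dₙ)` with `∑ Yₙ = 0`. In `EReal` a sum with a summand `-∞` is `-∞`. -/
def maxOverallUtility {Ω : Type*} [MeasurableSpace Ω] {P : Measure Ω} {N : ℕ}
    (u : Fin N → (Ω →ₘ[P] ℝ) → EReal) (D : Fin N → Set (AbsContProb P))
    (A : Fin N → Set (Ω →ₘ[P] ℝ)) (W : Fin N → (Ω →ₘ[P] ℝ)) : EReal :=
  ⨆ (X : Fin N → (Ω →ₘ[P] ℝ)) (_ : ∀ n, X n ∈ A n)
    (Y : Fin N → (Ω →ₘ[P] ℝ)) (_ : ∀ n, Y n ∈ strongL1 (⋂ m, D m)) (_ : ∑ n, Y n = 0),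
    ∑ n, u n (W n + X n + Y n)

/-- The sup-convolution of `u₁, …, u_N` on `L^∞`. -/
def supConvolution {Ω : Type*} [MeasurableSpace Ω] {P : Measure Ω} {N : ℕ}
    (u : Fin N → (Ω →ₘ[P] ℝ) → EReal) (X : Ω →ₘ[P] ℝ) : EReal :=
  ⨆ (Z : Fin N → (Ω →ₘ[P] ℝ)) (_ : ∀ n, Z n ∈ Linfty P) (_ : ∑ n, Z n = X), ∑ n, u n (Z n)

end

end CoherentUtility

/-! Upper bound: if `Q` lies in every `D n` and prices every `A n` nonpositively, then `u n (W n + X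
n + Y n)` is at most `E_Q (W n + Y n)`, and summation cancels the `Y n`.

Lower bound: let `c` be a real number below the infimum, and let the measures vary independently, as
tuples in the product of the `D n`. Each tuple is beaten by some attainable `Z`, that is, `c < ∑
E_{Q n} (Z n)`. If two components differ, a large multiple of a bounded variable separating them is
transferred from one agent to the other. If all components equal one `Q` outside some `riskNeutral
(A m)`, consistency supplies a trade in `A m` with real positive expectation, which is scaled up.
Otherwise `Z = W` works. The product is compact and closed under mixtures, so a minimax argument
gives one `Z` good for all tuples, up to `≤`. Since the coordinates are independent, the minimum
over tuples is `∑ u n (Z n)`.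

The sup-convolution is the case of zero cones. Maximality of its determining set follows from the
same argument applied to the pair `D n`, `{Q}`. -/

namespace CoherentUtility


/-! ### Minimax by finite-dimensional separation -/

/-- A minimax lemma: if for every point of a compact set `K` some member of a mixture-affine family
of continuous functions exceeds `c`, then some convex combination of the family is at least `c` on
all of `K`. -/
theorem exists_weights_of_forall_exists_lt {α ι : Type*} [TopologicalSpace α] {K : Set α}
    (hK : IsCompact K) (hne : K.Nonempty) {F : ι → α → ℝ} (hF : ∀ i, ContinuousOn (F i) K)
    (hmix : ∀ x ∈ K, ∀ y ∈ K, ∀ a b : ℝ, 0 < a → 0 < b → a + b = 1 →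
      ∃ z ∈ K, ∀ i, F i z = a * F i x + b * F i y)
    {c : ℝ} (h : ∀ x ∈ K, ∃ i, c < F i x) :
    ∃ (s : Finset α) (i : α → ι) (w : α → ℝ), (∀ x ∈ s, 0 ≤ w x) ∧ ∑ x ∈ s, w x = 1 ∧
      ∀ y ∈ K, c ≤ ∑ x ∈ s, w x * F (i x) y := by
  classical
  obtain ⟨x₀, hx₀⟩ := hne
  obtain ⟨i₀, -⟩ := h x₀ hx₀
  have h' : ∀ x, ∃ i, x ∈ K → c < F i x := fun x => by
    by_cases hx : x ∈ K
    · obtain ⟨i, hi⟩ := h x hx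
      exact ⟨i, fun _ => hi⟩
    · exact ⟨i₀, fun h => absurd h hx⟩
  choose i hi using h'
  obtain ⟨t, -, htK⟩ := hK.elim_nhdsWithin_subcover (fun x => {y | c < F (i x) y})
    (fun x hx => (hF (i x) x hx).eventually (lt_mem_nhds (hi x hx)))
  let Φ : α → (t → ℝ) := fun y x => F (i x) y
  have hconv : Convex ℝ (Φ '' K) := by
    rw [convex_iff_forall_pos]
    rintro _ ⟨x, hx, rfl⟩ _ ⟨y, hy, rfl⟩ a b ha hb hab
    obtain ⟨z, hz, hzF⟩ := hmix x hx y hy a b ha hb hab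
    exact ⟨z, hz, funext fun j => by simp [Φ, hzF]⟩
  -- By the choice of the cover, each point of `Φ '' K` has a coordinate above `c`, so it misses
  -- this open orthant. The separating functional provides the weights.
  let S : Set (t → ℝ) := univ.pi fun _ => Iio c
  have hdisj : Disjoint S (Φ '' K) := by
    rw [Set.disjoint_left]
    rintro _ hS ⟨y, hy, rfl⟩
    obtain ⟨x, hx, hxy⟩ := mem_iUnion₂.1 (htK hy)
    exact lt_asymm (a := c) hxy (hS ⟨x, hx⟩ (mem_univ _))
  obtain ⟨f, r, hfS, hfK⟩ := geometric_hahn_banach_open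
    (convex_pi fun _ _ => convex_Iio c) (isOpen_set_pi finite_univ fun _ _ => isOpen_Iio)
    hconv hdisj
  let v : t → ℝ := fun x => f (Pi.single x 1)
  have hf : ∀ p : t → ℝ, f p = ∑ x, p x * v x := fun p => by
    conv_lhs => rw [pi_eq_sum_univ' p]
    simp [v, map_sum]
  have hconst : ∀ d < c, (d * ∑ x, v x) < r := fun d hd => by
    have := hfS (fun _ => d) (fun _ _ => hd)
    rwa [hf, ← Finset.mul_sum] at this
  -- The orthant is unbounded below in each direction: with a negative coefficient, lowering that
  -- coordinate would push `f` past `r`. The value of `s` used in `h2` makes the left side exactly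
  -- `r`.
  have hv : ∀ x, 0 ≤ v x := fun x => by
    by_contra! hx
    have key : ∀ s : ℝ, 0 ≤ s → (c - 1) * (∑ x, v x) - s * v x < r := fun s hs => by
      have := hfS ((fun _ => c - 1) - Pi.single x s) (fun y _ => by
        by_cases hxy : y = x
        · subst hxy; simp; linarith
        · simp [hxy])
      rw [hf] at this
      simpa [sub_mul, Finset.sum_sub_distrib, ← Finset.mul_sum, Pi.single_apply] using this
    have h1 := hconst (c - 1) (by linarith)
    have h2 := key ((r - (c - 1) * ∑ x, v x) / (-v x)) (div_nonneg (by linarith) (by linarith))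
    rw [div_mul_eq_mul_div, lt_iff_not_ge] at h2
    apply h2
    rw [mul_div_assoc, div_neg, div_self hx.ne]
    linarith
  -- If all coefficients vanished, `f` would be zero and could not separate strictly.
  have hsum : 0 < ∑ x, v x := by
    refine lt_of_le_of_ne (Finset.sum_nonneg fun x _ => hv x) fun h0 => ?_
    have hv0 : ∀ x, v x = 0 := fun x =>
      (Finset.sum_eq_zero_iff_of_nonneg fun x _ => hv x).1 h0.symm x (Finset.mem_univ x)
    have h1 := hconst (c - 1) (by linarith)
    have h2 := hfK _ (mem_image_of_mem Φ hx₀)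
    rw [hf] at h2
    simp [hv0] at h1 h2
    linarith
  have hcr : c * ∑ x, v x ≤ r := by
    refine le_of_forall_pos_le_add fun ε hε => ?_
    have := hconst (c - ε / ∑ x, v x) (by linarith [div_pos hε hsum])
    rw [sub_mul, div_mul_cancel₀ _ hsum.ne'] at this
    linarith
  refine ⟨t, i, fun x => if hx : x ∈ t then v ⟨x, hx⟩ / ∑ x, v x else 0, fun x hx => ?_, ?_, ?_⟩
  · simp only [hx, dite_true]
    exact div_nonneg (hv _) hsum.le
  · rw [← Finset.sum_coe_sort t]
    simp only [Subtype.coe_eta, Finset.coe_mem, dite_true]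
    rw [← Finset.sum_div, div_self hsum.ne']
  · intro y hy
    rw [← Finset.sum_coe_sort t]
    have h2 := hfK _ (mem_image_of_mem Φ hy)
    rw [hf] at h2
    have : ∑ x : t, (if hx : (x : α) ∈ t then v ⟨x, hx⟩ / ∑ x, v x else 0) * F (i x) y
        = (∑ x : t, Φ y x * v x) / ∑ x, v x := by
      rw [Finset.sum_div]
      refine Finset.sum_congr rfl fun x _ => ?_
      simp [Φ, mul_comm, mul_div_assoc]
    rw [this, le_div_iff₀ hsum]
    exact hcr.trans h2


/-! ### Weak continuity of expectations -/

/-- The topology of weak convergence of the densities in `L¹(P)`. -/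
@[reducible]
noncomputable def weakTopology {Ω : Type*} [MeasurableSpace Ω] (P : Measure Ω) :
    TopologicalSpace (AbsContProb P) :=
  TopologicalSpace.induced (fun Q => toWeakSpace ℝ (Ω →₁[P] ℝ) (density Q)) inferInstance

attribute [local instance] weakTopology

variable {Ω : Type*} [MeasurableSpace Ω] {P : Measure Ω}

theorem IsWeaklyCompact.isCompact {D : Set (AbsContProb P)} (hD : IsWeaklyCompact D) :
    IsCompact D := by
  have h : IsInducing (fun Q : AbsContProb P => toWeakSpace ℝ (Ω →₁[P] ℝ) (density Q)) := ⟨rfl⟩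
  rw [h.isCompact_iff]
  rwa [IsWeaklyCompact, image_image] at hD

theorem expect_eq_integral {Q : AbsContProb P} {X : Ω →ₘ[P] ℝ}
    (hX : Integrable X (Q.1 : Measure Ω)) :
    expect Q X = ((∫ ω, X ω ∂(Q.1 : Measure Ω) : ℝ) : EReal) := by
  rw [integral_eq_lintegral_pos_part_sub_lintegral_neg_part hX, EReal.coe_sub,
    EReal.coe_ennreal_toReal, EReal.coe_ennreal_toReal]
  · rfl
  · exact hX.neg.lintegral_lt_top.ne
  · exact hX.lintegral_lt_top.ne

theorem aestronglyMeasurable_coeFn (Q : AbsContProb P) (X : Ω →ₘ[P] ℝ) :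
    AEStronglyMeasurable X (Q.1 : Measure Ω) :=
  X.stronglyMeasurable.aestronglyMeasurable

theorem mem_Linfty_iff {X : Ω →ₘ[P] ℝ} : X ∈ Linfty P ↔ ∃ C : ℝ, ∀ᵐ ω ∂P, |X ω| ≤ C := by
  constructor
  · intro h
    have h' : MemLp X ∞ P := Lp.mem_Lp_iff_memLp.1 h
    refine ⟨(eLpNormEssSup X P).toReal, ?_⟩
    filter_upwards [ae_le_eLpNormEssSup (f := X) (μ := P)] with ω hω
    have := ENNReal.toReal_mono (by simpa using h'.2.ne) hω
    simpa using this
  · rintro ⟨C, hC⟩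
    exact Lp.mem_Lp_iff_memLp.2
      (memLp_top_of_bound X.stronglyMeasurable.aestronglyMeasurable C hC)

theorem smul_mem_Linfty (c : ℝ) {X : Ω →ₘ[P] ℝ} (hX : X ∈ Linfty P) : c • X ∈ Linfty P :=
  Lp.const_smul_mem_Lp c ⟨X, hX⟩

theorem integrable_of_mem_Linfty (Q : AbsContProb P) {X : Ω →ₘ[P] ℝ} (hX : X ∈ Linfty P) :
    Integrable X (Q.1 : Measure Ω) := by
  obtain ⟨C, hC⟩ := mem_Linfty_iff.1 hX
  exact Integrable.of_bound (aestronglyMeasurable_coeFn Q X) C (Q.2.ae_le hC)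

/-- A bounded `X` acts on `L¹(P)` as a continuous functional, and `E_Q X` is its value at the
density of `Q`. -/
theorem continuous_integral_of_mem_Linfty [IsProbabilityMeasure P] {X : Ω →ₘ[P] ℝ}
    (hX : X ∈ Linfty P) :
    Continuous fun Q : AbsContProb P => ∫ ω, X ω ∂(Q.1 : Measure Ω) := by
  let L : (Ω →₁[P] ℝ) →L[ℝ] ℝ :=
    (ContinuousLinearMap.mul ℝ ℝ).lpPairing P ∞ 1 (⟨X, hX⟩ : Lp ℝ ∞ P)
  have hL : ∀ Q : AbsContProb P, ∫ ω, X ω ∂(Q.1 : Measure Ω) = L (density Q) := fun Q => by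
    simp only [L]
    rw [ContinuousLinearMap.lpPairing_eq_integral, ← integral_rnDeriv_smul Q.2]
    refine integral_congr_ae ?_
    filter_upwards [Integrable.coeFn_toL1
      (Measure.integrable_toReal_rnDeriv (μ := (Q.1 : Measure Ω)) (ν := P))] with ω hω
    simp only [ContinuousLinearMap.mul_apply', smul_eq_mul, density]
    rw [hω, mul_comm]
  simp_rw [hL]
  exact (WeakBilin.eval_continuous (topDualPairing ℝ (Ω →₁[P] ℝ)).flip L).comp
    continuous_induced_dom

theorem integrable_add {Q : AbsContProb P} {X Y : Ω →ₘ[P] ℝ}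
    (hX : Integrable X (Q.1 : Measure Ω)) (hY : Integrable Y (Q.1 : Measure Ω)) :
    Integrable ⇑(X + Y) (Q.1 : Measure Ω) :=
  (hX.add hY).congr (Q.2.ae_eq (AEEqFun.coeFn_add X Y)).symm

theorem integral_add_coeFn {Q : AbsContProb P} {X Y : Ω →ₘ[P] ℝ}
    (hX : Integrable X (Q.1 : Measure Ω)) (hY : Integrable Y (Q.1 : Measure Ω)) :
    ∫ ω, (X + Y) ω ∂(Q.1 : Measure Ω) =
      ∫ ω, X ω ∂(Q.1 : Measure Ω) + ∫ ω, Y ω ∂(Q.1 : Measure Ω) := by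
  rw [← integral_add hX hY]
  exact integral_congr_ae (Q.2.ae_eq (AEEqFun.coeFn_add X Y))

theorem integrable_smul {Q : AbsContProb P} {X : Ω →ₘ[P] ℝ} (c : ℝ)
    (hX : Integrable X (Q.1 : Measure Ω)) : Integrable ⇑(c • X) (Q.1 : Measure Ω) :=
  (hX.smul c).congr (Q.2.ae_eq (AEEqFun.coeFn_smul c X)).symm

theorem integral_smul_coeFn (Q : AbsContProb P) (c : ℝ) (X : Ω →ₘ[P] ℝ) :
    ∫ ω, (c • X) ω ∂(Q.1 : Measure Ω) = c * ∫ ω, X ω ∂(Q.1 : Measure Ω) := by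
  rw [← smul_eq_mul, ← integral_smul]
  exact integral_congr_ae (Q.2.ae_eq (AEEqFun.coeFn_smul c X))

theorem integrable_zero_coeFn (Q : AbsContProb P) :
    Integrable ⇑(0 : Ω →ₘ[P] ℝ) (Q.1 : Measure Ω) :=
  (integrable_zero _ _ _).congr (Q.2.ae_eq AEEqFun.coeFn_zero).symm

/-- The space of integrable random variables whose expectation depends on `Q ∈ D` weakly
continuously. -/
def continuousExpectation (D : Set (AbsContProb P)) : Submodule ℝ (Ω →ₘ[P] ℝ) where
  carrier := {X | (∀ Q ∈ D, Integrable X (Q.1 : Measure Ω)) ∧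
    ContinuousOn (fun Q : AbsContProb P => ∫ ω, X ω ∂(Q.1 : Measure Ω)) D}
  zero_mem' := by
    refine ⟨fun Q _ => integrable_zero_coeFn Q, (continuousOn_const (c := (0 : ℝ))).congr fun Q _ => ?_⟩
    rw [← integral_zero Ω ℝ (μ := (Q.1 : Measure Ω))]
    exact integral_congr_ae (Q.2.ae_eq AEEqFun.coeFn_zero)
  add_mem' := fun {X Y} hX hY => ⟨fun Q hQ => integrable_add (hX.1 Q hQ) (hY.1 Q hQ),
    (hX.2.add hY.2).congr fun Q hQ => integral_add_coeFn (hX.1 Q hQ) (hY.1 Q hQ)⟩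
  smul_mem' := fun c X hX => ⟨fun Q hQ => integrable_smul c (hX.1 Q hQ),
    (hX.2.const_smul c).congr fun Q _ => integral_smul_coeFn Q c X⟩

theorem integral_zero_coeFn (Q : AbsContProb P) :
    ∫ ω, (0 : Ω →ₘ[P] ℝ) ω ∂(Q.1 : Measure Ω) = 0 := by
  simpa using integral_smul_coeFn Q 0 (0 : Ω →ₘ[P] ℝ)

theorem integral_sum_smul {Q : AbsContProb P} {ι : Type*} (s : Finset ι) (w : ι → ℝ)
    {X : ι → (Ω →ₘ[P] ℝ)} (hX : ∀ i, Integrable (X i) (Q.1 : Measure Ω)) :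
    Integrable ⇑(∑ i ∈ s, w i • X i) (Q.1 : Measure Ω) ∧
      ∫ ω, (∑ i ∈ s, w i • X i) ω ∂(Q.1 : Measure Ω) =
        ∑ i ∈ s, w i * ∫ ω, X i ω ∂(Q.1 : Measure Ω) := by
  classical
  induction s using Finset.induction_on with
  | empty => exact ⟨by simpa using integrable_zero_coeFn Q, by simpa using integral_zero_coeFn Q⟩
  | insert i s hi ih =>
    simp only [Finset.sum_insert hi]
    have h := integrable_smul (w i) (hX i)
    exact ⟨integrable_add h ih.1, by rw [integral_add_coeFn h ih.1, ih.2, integral_smul_coeFn]⟩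

theorem expect_sum {Q : AbsContProb P} {ι : Type*} (s : Finset ι) {X : ι → (Ω →ₘ[P] ℝ)}
    (hX : ∀ i, Integrable (X i) (Q.1 : Measure Ω)) :
    expect Q (∑ i ∈ s, X i) = ((∑ i ∈ s, ∫ ω, X i ω ∂(Q.1 : Measure Ω) : ℝ) : EReal) := by
  have h := integral_sum_smul s (fun _ => (1 : ℝ)) hX
  simp only [one_smul, one_mul] at h
  rw [expect_eq_integral h.1, h.2]

theorem mem_continuousExpectation_of_mem_Linfty [IsProbabilityMeasure P]
    (D : Set (AbsContProb P)) {X : Ω →ₘ[P] ℝ} (hX : X ∈ Linfty P) :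
    X ∈ continuousExpectation D :=
  ⟨fun Q _ => integrable_of_mem_Linfty Q hX, (continuous_integral_of_mem_Linfty hX).continuousOn⟩

theorem mem_strongL1_of_mem_Linfty (D : Set (AbsContProb P)) {X : Ω →ₘ[P] ℝ}
    (hX : X ∈ Linfty P) : X ∈ strongL1 D := by
  obtain ⟨C, hC⟩ := mem_Linfty_iff.1 hX
  obtain ⟨k, hk⟩ := exists_nat_ge C
  refine tendsto_const_nhds.congr' ?_
  filter_upwards [eventually_ge_atTop k] with n hn
  symm
  simp only [ENNReal.iSup_eq_zero]
  intro Q _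
  refine setLIntegral_measure_zero _ _ ?_
  have : ∀ᵐ ω ∂(Q.1 : Measure Ω), ¬ (n : ℝ) < |X ω| := by
    filter_upwards [Q.2.ae_le hC] with ω hω
    exact not_lt.2 (hω.trans (hk.trans (by exact_mod_cast hn)))
  simpa [ae_iff] using this

theorem measurableSet_lt_abs (X : Ω →ₘ[P] ℝ) (r : ℝ) : MeasurableSet {ω | r < |X ω|} :=
  measurableSet_lt measurable_const X.measurable.abs

theorem integrable_of_mem_strongL1 {D : Set (AbsContProb P)} {X : Ω →ₘ[P] ℝ}
    (hX : X ∈ strongL1 D) {Q : AbsContProb P} (hQ : Q ∈ D) :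
    Integrable X (Q.1 : Measure Ω) := by
  obtain ⟨n, hn⟩ := ((tendsto_order.1 hX).2 1 one_pos).exists
  have hn' := (le_iSup₂ (f := fun (Q : AbsContProb P) (_ : Q ∈ D) =>
    ∫⁻ ω in {ω | (n : ℝ) < |X ω|}, ENNReal.ofReal |X ω| ∂(Q.1 : Measure Ω)) Q hQ).trans_lt hn
  rw [← integrableOn_univ, ← union_compl_self {ω | (n : ℝ) < |X ω|}]
  refine IntegrableOn.union ⟨(aestronglyMeasurable_coeFn Q X).restrict, ?_⟩ ?_
  · rw [hasFiniteIntegral_iff_norm]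
    exact hn'.trans ENNReal.one_lt_top
  · refine Measure.integrableOn_of_bounded (M := n) (measure_ne_top _ _)
      (aestronglyMeasurable_coeFn Q X) ?_
    filter_upwards [ae_restrict_mem (measurableSet_lt_abs X n).compl] with ω hω
    exact not_lt.1 hω

/-- The truncation `X I(|X| ≤ r)`. -/
noncomputable def truncate (X : Ω →ₘ[P] ℝ) (r : ℝ) : Ω →ₘ[P] ℝ :=
  AEEqFun.mk ({ω | r < |X ω|}ᶜ.indicator X)
    (X.stronglyMeasurable.indicator (measurableSet_lt_abs X r).compl).aestronglyMeasurable

theorem coeFn_truncate (X : Ω →ₘ[P] ℝ) (r : ℝ) :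
    truncate X r =ᵐ[P] {ω | r < |X ω|}ᶜ.indicator X :=
  AEEqFun.coeFn_mk _ _

theorem truncate_mem_Linfty (X : Ω →ₘ[P] ℝ) {r : ℝ} (hr : 0 ≤ r) : truncate X r ∈ Linfty P := by
  refine mem_Linfty_iff.2 ⟨r, ?_⟩
  filter_upwards [coeFn_truncate X r] with ω hω
  rw [hω]
  by_cases h : r < |X ω|
  · simpa [h] using hr
  · rw [indicator_of_mem (by simpa using h)]
    exact not_lt.1 h

/-- The tail condition says that the expectations of the bounded truncations converge uniformly on
`D`; a uniform limit of continuous functions is continuous. -/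
theorem mem_continuousExpectation_of_mem_strongL1 [IsProbabilityMeasure P]
    {D : Set (AbsContProb P)} {X : Ω →ₘ[P] ℝ} (hX : X ∈ strongL1 D) :
    X ∈ continuousExpectation D := by
  refine ⟨fun Q hQ => integrable_of_mem_strongL1 hX hQ, ?_⟩
  refine TendstoUniformlyOn.continuousOn (p := (atTop : Filter ℕ))
    (F := fun (n : ℕ) Q => ∫ ω, truncate X n ω ∂(Q.1 : Measure Ω)) ?_
    (Eventually.of_forall fun n => (continuous_integral_of_mem_Linfty
      (truncate_mem_Linfty X n.cast_nonneg)).continuousOn).frequently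
  rw [Metric.tendstoUniformlyOn_iff]
  intro ε hε
  filter_upwards [(tendsto_order.1 hX).2 (ENNReal.ofReal ε) (ENNReal.ofReal_pos.2 hε)] with n hn
  intro Q hQ
  have hn' := (le_iSup₂ (f := fun (Q : AbsContProb P) (_ : Q ∈ D) =>
    ∫⁻ ω in {ω | (n : ℝ) < |X ω|}, ENNReal.ofReal |X ω| ∂(Q.1 : Measure Ω)) Q hQ).trans_lt hn
  have hms := measurableSet_lt_abs X n
  rw [integral_congr_ae (Q.2.ae_eq (coeFn_truncate X n)), integral_indicator hms.compl,
    ← integral_add_compl hms (integrable_of_mem_strongL1 hX hQ), Real.dist_eq, add_sub_cancel_right]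
  have h1 : ∫ ω in {ω | (n : ℝ) < |X ω|}, |X ω| ∂(Q.1 : Measure Ω) < ε := by
    rw [integral_eq_lintegral_of_nonneg_ae (Eventually.of_forall fun _ => abs_nonneg _)
      (aestronglyMeasurable_coeFn Q X).norm.restrict]
    exact (ENNReal.lt_ofReal_iff_toReal_lt (hn'.trans ENNReal.ofReal_lt_top).ne).1 hn'
  exact (abs_integral_le_integral_abs).trans_lt h1


/-! ### Extended expectations, mixtures and determining sets -/

theorem expect_eq_bot {Q : AbsContProb P} {X : Ω →ₘ[P] ℝ}
    (h : ∫⁻ ω, ENNReal.ofReal (-X ω) ∂(Q.1 : Measure Ω) = ∞) : expect Q X = ⊥ := by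
  simp [expect, h]

theorem expect_eq_top {Q : AbsContProb P} {X : Ω →ₘ[P] ℝ}
    (h : ∫⁻ ω, ENNReal.ofReal (X ω) ∂(Q.1 : Measure Ω) = ∞)
    (h' : ∫⁻ ω, ENNReal.ofReal (-X ω) ∂(Q.1 : Measure Ω) ≠ ∞) : expect Q X = ⊤ := by
  rw [expect, h, ← EReal.coe_ennreal_toReal h', EReal.coe_ennreal_top, EReal.top_sub_coe]

theorem integrable_of_lintegral_ne_top {Q : AbsContProb P} {X : Ω →ₘ[P] ℝ}
    (h : ∫⁻ ω, ENNReal.ofReal (X ω) ∂(Q.1 : Measure Ω) ≠ ∞)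
    (h' : ∫⁻ ω, ENNReal.ofReal (-X ω) ∂(Q.1 : Measure Ω) ≠ ∞) :
    Integrable X (Q.1 : Measure Ω) := by
  refine ⟨aestronglyMeasurable_coeFn Q X, ?_⟩
  rw [hasFiniteIntegral_iff_norm]
  refine lt_of_le_of_lt (lintegral_mono fun ω => ?_)
    ((lintegral_add_left X.measurable.ennreal_ofReal _).trans_lt
      (ENNReal.add_lt_top.2 ⟨h.lt_top, h'.lt_top⟩))
  rcases le_total 0 (X ω) with hω | hω
  · rw [Real.norm_of_nonneg hω]
    exact le_self_add
  · rw [Real.norm_of_nonpos hω]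
    exact le_add_self

/-- Only a non-integrable `X` is delicate. Then `E_Q X ≤ 0` forces `E_Q X⁻ = ∞`, and `X⁻ ≤ Z⁺ + (Z +
X)⁻` with `Z` integrable passes this on to `Z + X`. -/
theorem expect_add_le {Q : AbsContProb P} {X Z : Ω →ₘ[P] ℝ}
    (hZ : Integrable Z (Q.1 : Measure Ω)) (hX : expect Q X ≤ 0) :
    expect Q (Z + X) ≤ ((∫ ω, Z ω ∂(Q.1 : Measure Ω) : ℝ) : EReal) := by
  by_cases hXi : Integrable X (Q.1 : Measure Ω)
  · rw [expect_eq_integral hXi] at hX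
    rw [expect_eq_integral (integrable_add hZ hXi), integral_add_coeFn hZ hXi]
    have : ∫ ω, X ω ∂(Q.1 : Measure Ω) ≤ 0 := by exact_mod_cast hX
    exact_mod_cast (by linarith)
  · have hneg : ∫⁻ ω, ENNReal.ofReal (-X ω) ∂(Q.1 : Measure Ω) = ∞ := by
      by_contra h'
      by_cases h : ∫⁻ ω, ENNReal.ofReal (X ω) ∂(Q.1 : Measure Ω) = ∞
      · rw [expect_eq_top h h'] at hX
        simp at hX
      · exact hXi (integrable_of_lintegral_ne_top h h')
    rw [expect_eq_bot]
    · exact bot_le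
    · by_contra h
      have hle : ∫⁻ ω, ENNReal.ofReal (-X ω) ∂(Q.1 : Measure Ω) ≤
          ∫⁻ ω, ENNReal.ofReal (Z ω) + ENNReal.ofReal (-(Z + X) ω) ∂(Q.1 : Measure Ω) := by
        refine lintegral_mono_ae ?_
        filter_upwards [Q.2.ae_eq (AEEqFun.coeFn_add Z X)] with ω hω
        rw [hω, Pi.add_apply]
        refine le_trans (ENNReal.ofReal_le_ofReal ?_) ENNReal.ofReal_add_le
        linarith
      rw [hneg, lintegral_add_left Z.measurable.ennreal_ofReal, top_le_iff,
        ENNReal.add_eq_top] at hle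
      exact hle.elim hZ.lintegral_lt_top.ne h

/-- The mixture `a Q + b R` of two probability measures. -/
noncomputable def mixture (Q R : AbsContProb P) (a b : ℝ) (ha : 0 < a) (hb : 0 < b)
    (hab : a + b = 1) : AbsContProb P :=
  ⟨⟨ENNReal.ofReal a • (Q.1 : Measure Ω) + ENNReal.ofReal b • (R.1 : Measure Ω),
    ⟨by simp [← ENNReal.ofReal_add ha.le hb.le, hab]⟩⟩,
    (Q.2.smul_left _).add_left (R.2.smul_left _)⟩

theorem coe_mixture (Q R : AbsContProb P) {a b : ℝ} (ha : 0 < a) (hb : 0 < b) (hab : a + b = 1) :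
    ((mixture Q R a b ha hb hab).1 : Measure Ω) =
      ENNReal.ofReal a • (Q.1 : Measure Ω) + ENNReal.ofReal b • (R.1 : Measure Ω) :=
  rfl

theorem lintegral_mixture (Q R : AbsContProb P) {a b : ℝ} (ha : 0 < a) (hb : 0 < b)
    (hab : a + b = 1) (f : Ω → ℝ≥0∞) :
    ∫⁻ ω, f ω ∂((mixture Q R a b ha hb hab).1 : Measure Ω) =
      ENNReal.ofReal a * ∫⁻ ω, f ω ∂(Q.1 : Measure Ω) +
        ENNReal.ofReal b * ∫⁻ ω, f ω ∂(R.1 : Measure Ω) := by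
  rw [coe_mixture, lintegral_add_measure, lintegral_smul_measure, lintegral_smul_measure]
  rfl

theorem integral_mixture {Q R : AbsContProb P} {a b : ℝ} (ha : 0 < a) (hb : 0 < b)
    (hab : a + b = 1) {X : Ω →ₘ[P] ℝ} (hQ : Integrable X (Q.1 : Measure Ω))
    (hR : Integrable X (R.1 : Measure Ω)) :
    Integrable X ((mixture Q R a b ha hb hab).1 : Measure Ω) ∧
      ∫ ω, X ω ∂((mixture Q R a b ha hb hab).1 : Measure Ω) =
        a * ∫ ω, X ω ∂(Q.1 : Measure Ω) + b * ∫ ω, X ω ∂(R.1 : Measure Ω) := by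
  have hQ' := hQ.smul_measure (c := ENNReal.ofReal a) ENNReal.ofReal_ne_top
  have hR' := hR.smul_measure (c := ENNReal.ofReal b) ENNReal.ofReal_ne_top
  rw [coe_mixture]
  refine ⟨hQ'.add_measure hR', ?_⟩
  rw [integral_add_measure hQ' hR', integral_smul_measure, integral_smul_measure,
    ENNReal.toReal_ofReal ha.le, ENNReal.toReal_ofReal hb.le, smul_eq_mul, smul_eq_mul]

/-- For `c ≠ ⊥` both negative parts are finite, so `∞ - ∞` cannot occur. Either the positive part is
infinite under the mixture, or `X` is integrable under both measures (as `a, b > 0`) and the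
expectation is affine. -/
theorem le_expect_mixture {Q R : AbsContProb P} {a b : ℝ} (ha : 0 < a) (hb : 0 < b)
    (hab : a + b = 1) {X : Ω →ₘ[P] ℝ} {c : EReal} (hQ : c ≤ expect Q X) (hR : c ≤ expect R X) :
    c ≤ expect (mixture Q R a b ha hb hab) X := by
  have ha' : ENNReal.ofReal a ≠ 0 := by simpa using ha
  have hb' : ENNReal.ofReal b ≠ 0 := by simpa using hb
  rcases eq_or_ne c ⊥ with rfl | hc
  · exact bot_le
  have hQn : ∫⁻ ω, ENNReal.ofReal (-X ω) ∂(Q.1 : Measure Ω) ≠ ∞ := fun h => by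
    rw [expect_eq_bot h, le_bot_iff] at hQ
    exact hc hQ
  have hRn : ∫⁻ ω, ENNReal.ofReal (-X ω) ∂(R.1 : Measure Ω) ≠ ∞ := fun h => by
    rw [expect_eq_bot h, le_bot_iff] at hR
    exact hc hR
  by_cases hp : ∫⁻ ω, ENNReal.ofReal (X ω) ∂((mixture Q R a b ha hb hab).1 : Measure Ω) = ∞
  · rw [expect_eq_top hp]
    · exact le_top
    · rw [lintegral_mixture]
      exact ENNReal.add_ne_top.2
        ⟨ENNReal.mul_ne_top ENNReal.ofReal_ne_top hQn, ENNReal.mul_ne_top ENNReal.ofReal_ne_top hRn⟩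
  · rw [lintegral_mixture] at hp
    obtain ⟨hQp, hRp⟩ := ENNReal.add_ne_top.1 hp
    have hQi := integrable_of_lintegral_ne_top (fun h => hQp (by rw [h, ENNReal.mul_top ha'])) hQn
    have hRi := integrable_of_lintegral_ne_top (fun h => hRp (by rw [h, ENNReal.mul_top hb'])) hRn
    obtain ⟨hi, hint⟩ := integral_mixture ha hb hab hQi hRi
    rw [expect_eq_integral hi, hint]
    rw [expect_eq_integral hQi] at hQ
    rw [expect_eq_integral hRi] at hR
    induction c with
    | bot => exact bot_le
    | top => simp at hQ
    | coe c =>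
      have h1 : c ≤ _ := EReal.coe_le_coe_iff.1 hQ
      have h2 : c ≤ _ := EReal.coe_le_coe_iff.1 hR
      refine EReal.coe_le_coe_iff.2 ?_
      calc c = a * c + b * c := by rw [← add_mul, hab, one_mul]
        _ ≤ _ := add_le_add (mul_le_mul_of_nonneg_left h1 ha.le)
          (mul_le_mul_of_nonneg_left h2 hb.le)

/-- Adjoining such a `Q` leaves the infimum unchanged, and `D` is the largest representing set.
Convexity of determining sets follows from this. -/
theorem IsCoherentUtilityOn.mem_of_forall_le {S : Set (Ω →ₘ[P] ℝ)} {u : (Ω →ₘ[P] ℝ) → EReal}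
    {D : Set (AbsContProb P)} (h : IsCoherentUtilityOn S u D) {Q : AbsContProb P}
    (hQ : ∀ X ∈ S, u X ≤ expect Q X) : Q ∈ D := by
  have hle : insert Q D ≤ D := h.2 ⟨insert_nonempty _ _, fun X hX => ?_⟩
  · exact hle (mem_insert Q D)
  rw [iInf_insert, ← h.1.2 X hX, inf_eq_right.2 (hQ X hX)]

theorem IsCoherentUtilityOn.le_expect {S : Set (Ω →ₘ[P] ℝ)} {u : (Ω →ₘ[P] ℝ) → EReal}
    {D : Set (AbsContProb P)} (h : IsCoherentUtilityOn S u D) {Q : AbsContProb P} (hQ : Q ∈ D)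
    {X : Ω →ₘ[P] ℝ} (hX : X ∈ S) : u X ≤ expect Q X :=
  (h.1.2 X hX).trans_le (iInf₂_le Q hQ)

/-- A set of probability measures is closed under mixtures. -/
def MixtureClosed (D : Set (AbsContProb P)) : Prop :=
  ∀ Q ∈ D, ∀ R ∈ D, ∀ (a b : ℝ) (ha : 0 < a) (hb : 0 < b) (hab : a + b = 1),
    mixture Q R a b ha hb hab ∈ D

theorem IsCoherentUtilityOn.mixtureClosed {S : Set (Ω →ₘ[P] ℝ)} {u : (Ω →ₘ[P] ℝ) → EReal}
    {D : Set (AbsContProb P)} (h : IsCoherentUtilityOn S u D) : MixtureClosed D :=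
  fun _ hQ _ hR _ _ ha hb hab => h.mem_of_forall_le fun _ hX =>
    le_expect_mixture ha hb hab (h.le_expect hQ hX) (h.le_expect hR hX)

/-! ### Minimax over tuples of measures -/

/-- The minimax lemma for the functionals `Q ↦ ∑ₙ E_{Qₙ} Zₙ` on a product of weakly compact sets
of measures. -/
theorem exists_forall_le_sum_integral {N : ℕ} {D : Fin N → Set (AbsContProb P)}
    (hne : ∀ n, (D n).Nonempty) (hD : ∀ n, IsCompact (D n)) (hmix : ∀ n, MixtureClosed (D n))
    {C : Set (Fin N → (Ω →ₘ[P] ℝ))} (hC : Convex ℝ C)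
    (hCD : ∀ Z ∈ C, ∀ n, Z n ∈ continuousExpectation (D n)) {c : ℝ}
    (h : ∀ Q : Fin N → AbsContProb P, (∀ n, Q n ∈ D n) →
      ∃ Z ∈ C, c < ∑ n, ∫ ω, Z n ω ∂((Q n).1 : Measure Ω)) :
    ∃ Z ∈ C, ∀ Q : Fin N → AbsContProb P, (∀ n, Q n ∈ D n) →
      c ≤ ∑ n, ∫ ω, Z n ω ∂((Q n).1 : Measure Ω) := by
  have hmem : ∀ Q : Fin N → AbsContProb P, Q ∈ univ.pi D → ∀ n, Q n ∈ D n :=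
    fun Q hQ n => hQ n (mem_univ n)
  obtain ⟨s, Z, w, hw, hw1, hle⟩ := exists_weights_of_forall_exists_lt (ι := C) (c := c)
    (F := fun Z Q => ∑ n, ∫ ω, Z.1 n ω ∂((Q n).1 : Measure Ω))
    (isCompact_univ_pi hD) (univ_pi_nonempty_iff.2 hne)
    (fun Z => continuousOn_finsetSum _ fun n _ => ((hCD Z.1 Z.2 n).2.comp
      (continuous_apply n).continuousOn fun Q hQ => hmem Q hQ n))
    (fun Q hQ R hR a b ha hb hab => by
      refine ⟨fun n => mixture (Q n) (R n) a b ha hb hab,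
        fun n _ => hmix n _ (hmem Q hQ n) _ (hmem R hR n) a b ha hb hab, fun Z => ?_⟩
      rw [Finset.mul_sum, Finset.mul_sum, ← Finset.sum_add_distrib]
      exact Finset.sum_congr rfl fun n _ => (integral_mixture ha hb hab
        ((hCD Z.1 Z.2 n).1 _ (hmem Q hQ n)) ((hCD Z.1 Z.2 n).1 _ (hmem R hR n))).2)
    (fun Q hQ => by
      obtain ⟨Z, hZ, hlt⟩ := h Q (hmem Q hQ)
      exact ⟨⟨Z, hZ⟩, hlt⟩)
  refine ⟨∑ x ∈ s, w x • (Z x).1, hC.sum_mem hw hw1 fun x _ => (Z x).2, fun Q hQ => ?_⟩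
  refine (hle Q fun n _ => hQ n).trans_eq ?_
  simp only [Finset.mul_sum]
  rw [Finset.sum_comm]
  refine Finset.sum_congr rfl fun n _ => ?_
  rw [← (integral_sum_smul s w fun x => (hCD _ (Z x).2 n).1 _ (hQ n)).2]
  simp [Finset.sum_apply]

theorem exists_expect_eq_iInf {D : Set (AbsContProb P)} (hne : D.Nonempty) (hD : IsCompact D)
    {X : Ω →ₘ[P] ℝ} (hX : X ∈ continuousExpectation D) :
    ∃ Q ∈ D, ⨅ R ∈ D, expect R X = ((∫ ω, X ω ∂(Q.1 : Measure Ω) : ℝ) : EReal) := by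
  obtain ⟨Q, hQ, hmin⟩ := hD.exists_isMinOn hne hX.2
  refine ⟨Q, hQ, le_antisymm ?_ (le_iInf₂ fun R hR => ?_)⟩
  · rw [← expect_eq_integral (hX.1 Q hQ)]
    exact iInf₂_le Q hQ
  · rw [expect_eq_integral (hX.1 R hR)]
    exact EReal.coe_le_coe_iff.2 (hmin hR)

/-- Bounded variables form a space closed under negation, so one-sided inequalities between the
expectations become equalities; indicators then identify the measures. -/
theorem exists_integral_lt [IsProbabilityMeasure P] {Q R : AbsContProb P} (h : Q ≠ R) :
    ∃ X ∈ Linfty P, ∫ ω, X ω ∂(Q.1 : Measure Ω) < ∫ ω, X ω ∂(R.1 : Measure Ω) := by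
  by_contra! hge
  have h' : ∀ X ∈ Linfty P,
      ∫ ω, X ω ∂(Q.1 : Measure Ω) = ∫ ω, X ω ∂(R.1 : Measure Ω) := fun X hX => by
    refine le_antisymm ?_ (hge X hX)
    have := hge ((-1 : ℝ) • X) (smul_mem_Linfty (-1) hX)
    rw [integral_smul_coeFn, integral_smul_coeFn] at this
    linarith
  refine h (Subtype.ext (Subtype.ext (Measure.ext fun B hB => ?_)))
  have hint : ∀ S : AbsContProb P, ∫ ω, AEEqFun.mk (B.indicator (fun _ => (1 : ℝ)))
      (stronglyMeasurable_const.indicator hB).aestronglyMeasurable ω ∂(S.1 : Measure Ω) =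
      (S.1 : Measure Ω).real B := fun S => by
    rw [integral_congr_ae (S.2.ae_eq (AEEqFun.coeFn_mk (μ := P) _
      (stronglyMeasurable_const.indicator hB).aestronglyMeasurable)), integral_indicator_const _ hB]
    simp
  have := h' (AEEqFun.mk (B.indicator (fun _ => (1 : ℝ)))
    (stronglyMeasurable_const.indicator hB).aestronglyMeasurable) (mem_Linfty_iff.2 ⟨1, by
      filter_upwards [AEEqFun.coeFn_mk (μ := P) (B.indicator (fun _ => (1 : ℝ)))
        (stronglyMeasurable_const.indicator hB).aestronglyMeasurable] with ω hω
      rw [hω]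
      by_cases hωB : ω ∈ B <;> simp [hωB]⟩)
  rw [hint, hint] at this
  exact (measureReal_eq_measureReal_iff (measure_ne_top (Q.1 : Measure Ω) B)
    (measure_ne_top (R.1 : Measure Ω) B)).1 this


/-! ### Attainable positions and the lower bound -/

theorem coe_finset_sum_real {ι : Type*} (s : Finset ι) (f : ι → ℝ) :
    ((∑ i ∈ s, f i : ℝ) : EReal) = ∑ i ∈ s, (f i : EReal) := by
  classical
  induction s using Finset.induction_on with
  | empty => simp
  | insert i s hi ih => rw [Finset.sum_insert hi, Finset.sum_insert hi, EReal.coe_add, ih]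

theorem exists_lt_sum_integral_add_smul {N : ℕ} {Q : Fin N → AbsContProb P}
    {W V : Fin N → (Ω →ₘ[P] ℝ)} (hW : ∀ n, Integrable (W n) ((Q n).1 : Measure Ω))
    (hV : ∀ n, Integrable (V n) ((Q n).1 : Measure Ω))
    (hpos : 0 < ∑ n, ∫ ω, V n ω ∂((Q n).1 : Measure Ω)) (c : ℝ) :
    ∃ t : ℝ, 0 ≤ t ∧ c < ∑ n, ∫ ω, (W n + t • V n) ω ∂((Q n).1 : Measure Ω) := by
  set δ := ∑ n, ∫ ω, V n ω ∂((Q n).1 : Measure Ω)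
  set b := ∑ n, ∫ ω, W n ω ∂((Q n).1 : Measure Ω) with hb
  -- Then `t * δ = |c - b| + 1`, which exceeds `c - b`.
  refine ⟨(|c - b| + 1) / δ, by positivity, ?_⟩
  have h : ∀ t : ℝ, ∑ n, ∫ ω, (W n + t • V n) ω ∂((Q n).1 : Measure Ω) = b + t * δ := fun t => by
    rw [hb, Finset.mul_sum, ← Finset.sum_add_distrib]
    exact Finset.sum_congr rfl fun n _ => by
      rw [integral_add_coeFn (hW n) (integrable_smul t (hV n)), integral_smul_coeFn]
  rw [h, div_mul_cancel₀ _ hpos.ne']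
  linarith [le_abs_self (c - b)]

/-- The random variables `W + X + Y` with `Xₙ ∈ Aₙ` of continuous expectation and bounded `Yₙ` of
sum zero. -/
def attainable {N : ℕ} (D : Fin N → Set (AbsContProb P)) (A : Fin N → PointedCone ℝ (Ω →ₘ[P] ℝ))
    (W : Fin N → (Ω →ₘ[P] ℝ)) : Set (Fin N → (Ω →ₘ[P] ℝ)) :=
  {Z | ∃ X Y : Fin N → (Ω →ₘ[P] ℝ), (∀ n, X n ∈ A n) ∧
    (∀ n, X n ∈ continuousExpectation (D n)) ∧ (∀ n, Y n ∈ Linfty P) ∧ ∑ n, Y n = 0 ∧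
    ∀ n, Z n = W n + X n + Y n}

theorem add_mem_Linfty {X Y : Ω →ₘ[P] ℝ} (hX : X ∈ Linfty P) (hY : Y ∈ Linfty P) :
    X + Y ∈ Linfty P :=
  (Lp ℝ ∞ P).add_mem hX hY

theorem zero_mem_Linfty : (0 : Ω →ₘ[P] ℝ) ∈ Linfty P :=
  (Lp ℝ ∞ P).zero_mem

theorem convex_attainable {N : ℕ} (D : Fin N → Set (AbsContProb P))
    (A : Fin N → PointedCone ℝ (Ω →ₘ[P] ℝ)) (W : Fin N → (Ω →ₘ[P] ℝ)) :
    Convex ℝ (attainable D A W) := by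
  rintro Z ⟨X, Y, hXA, hX, hY, hY0, hZ⟩ Z' ⟨X', Y', hXA', hX', hY', hY0', hZ'⟩ a b ha hb hab
  refine ⟨fun n => a • X n + b • X' n, fun n => a • Y n + b • Y' n,
    fun n => (A n).add_mem ((A n).smul_mem ha (hXA n))
      ((A n).smul_mem hb (hXA' n)),
    fun n => Submodule.add_mem _ (Submodule.smul_mem _ _ (hX n)) (Submodule.smul_mem _ _ (hX' n)),
    fun n => add_mem_Linfty (smul_mem_Linfty a (hY n)) (smul_mem_Linfty b (hY' n)), ?_,
    fun n => ?_⟩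
  · rw [Finset.sum_add_distrib, ← Finset.smul_sum, ← Finset.smul_sum, hY0, hY0']
    simp
  · have hW : W n = a • W n + b • W n := by rw [← add_smul, hab, one_smul]
    rw [Pi.add_apply, Pi.smul_apply, Pi.smul_apply, hZ, hZ']
    conv_rhs => rw [hW]
    simp only [smul_add]
    abel

theorem apply_mem_continuousExpectation_of_mem_attainable [IsProbabilityMeasure P] {N : ℕ}
    {D : Fin N → Set (AbsContProb P)} {A : Fin N → PointedCone ℝ (Ω →ₘ[P] ℝ)}
    {W : Fin N → (Ω →ₘ[P] ℝ)} (hW : ∀ n, W n ∈ continuousExpectation (D n))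
    {Z : Fin N → (Ω →ₘ[P] ℝ)} (hZ : Z ∈ attainable D A W) (n : Fin N) :
    Z n ∈ continuousExpectation (D n) := by
  obtain ⟨X, Y, -, hX, hY, -, h⟩ := hZ
  rw [h n]
  exact Submodule.add_mem _ (Submodule.add_mem _ (hW n) (hX n))
    (mem_continuousExpectation_of_mem_Linfty _ (hY n))

theorem exists_attainable_forall_le [IsProbabilityMeasure P] {N : ℕ} (hN : 0 < N)
    {D : Fin N → Set (AbsContProb P)} (hne : ∀ n, (D n).Nonempty) (hD : ∀ n, IsCompact (D n))
    (hmix : ∀ n, MixtureClosed (D n)) (A : Fin N → PointedCone ℝ (Ω →ₘ[P] ℝ))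
    (hA : ∀ n, IsConsistent (D n) (A n : Set (Ω →ₘ[P] ℝ))) {W : Fin N → (Ω →ₘ[P] ℝ)}
    (hW : ∀ n, W n ∈ continuousExpectation (D n)) {c : ℝ}
    (hc : (c : EReal) < ⨅ Q ∈ ⋂ n, D n ∩ riskNeutral (A n : Set (Ω →ₘ[P] ℝ)),
      expect Q (∑ n, W n)) :
    ∃ Z ∈ attainable D A W, ∀ Q : Fin N → AbsContProb P, (∀ n, Q n ∈ D n) →
      c ≤ ∑ n, ∫ ω, Z n ω ∂((Q n).1 : Measure Ω) := by
  classical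
  refine exists_forall_le_sum_integral hne hD hmix (convex_attainable D A W)
    (fun Z hZ => apply_mem_continuousExpectation_of_mem_attainable hW hZ) fun Q hQ => ?_
  have hWi : ∀ n, Integrable (W n) ((Q n).1 : Measure Ω) := fun n => (hW n).1 _ (hQ n)
  let n₀ : Fin N := ⟨0, hN⟩
  by_cases heq : ∀ n, Q n = Q n₀
  · by_cases hR : ∀ n, Q n ∈ riskNeutral (A n : Set (Ω →ₘ[P] ℝ))
    · refine ⟨W, ⟨0, 0, fun n => (A n).zero_mem, fun n => Submodule.zero_mem _,
        fun n => zero_mem_Linfty, by simp, fun n => by simp⟩, ?_⟩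
      have hmem : Q n₀ ∈ ⋂ n, D n ∩ riskNeutral (A n : Set (Ω →ₘ[P] ℝ)) :=
        mem_iInter.2 fun n => by rw [← heq n]; exact ⟨hQ n, hR n⟩
      have hlt := hc.trans_le (iInf₂_le _ hmem)
      rw [expect_sum _ fun n => by rw [← heq n]; exact hWi n] at hlt
      refine (EReal.coe_lt_coe_iff.1 hlt).trans_eq (Finset.sum_congr rfl fun n _ => ?_)
      rw [heq n]
    · push Not at hR
      obtain ⟨m, hm⟩ := hR
      -- A violating element of `A m` may lack a finite expectation; consistency replaces it by one
      -- in `strongL1 (D m)`, where expectations are real and weakly continuous.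
      obtain ⟨A', hA', hAA'⟩ := hA m
      have hm' : Q m ∉ riskNeutral A' := fun h =>
        hm (hAA'.symm.subset ⟨hQ m, h⟩).2
      simp only [riskNeutral, mem_ofPred_eq, not_forall, not_le] at hm'
      obtain ⟨X, hX, hpos⟩ := hm'
      have hXc : X ∈ continuousExpectation (D m) :=
        mem_continuousExpectation_of_mem_strongL1 (hA' hX).2
      rw [expect_eq_integral (hXc.1 _ (hQ m))] at hpos
      have hV : ∀ n, (Pi.single m X : Fin N → (Ω →ₘ[P] ℝ)) n ∈ continuousExpectation (D n) := by
        intro n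
        by_cases hn : n = m
        · subst hn; simpa using hXc
        · rw [Pi.single_eq_of_ne hn]; exact Submodule.zero_mem _
      obtain ⟨t, ht, hlt⟩ := exists_lt_sum_integral_add_smul (V := Pi.single m X) hWi
        (fun n => (hV n).1 _ (hQ n)) (by
          rw [Fintype.sum_eq_single m fun n hn => by
            rw [Pi.single_eq_of_ne hn, integral_zero_coeFn], Pi.single_eq_same]
          exact_mod_cast hpos) c
      refine ⟨_, ⟨fun n => t • (Pi.single m X : Fin N → (Ω →ₘ[P] ℝ)) n, 0, fun n => ?_,
        fun n => Submodule.smul_mem _ _ (hV n), fun n => zero_mem_Linfty, by simp,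
        fun n => by simp⟩, hlt⟩
      refine (A n).smul_mem ht ?_
      by_cases hn : n = m
      · subst hn; simpa using (hA' hX).1
      · rw [Pi.single_eq_of_ne hn]; exact (A n).zero_mem
  · push Not at heq
    obtain ⟨m, hm⟩ := heq
    have hmn : m ≠ n₀ := fun h => hm (by rw [h])
    obtain ⟨X, hX, hlt⟩ := exists_integral_lt hm.symm
    -- Agent `n₀` hands `X` to agent `m`: the sum is zero, while the total expectation is `E_{Q m} X
    -- - E_{Q n₀} X > 0`.
    let V : Fin N → (Ω →ₘ[P] ℝ) := Pi.single m X + Pi.single n₀ ((-1 : ℝ) • X)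
    have hVm : V m = X := by simp [V, Pi.single_eq_of_ne hmn]
    have hVn₀ : V n₀ = (-1 : ℝ) • X := by simp [V, Pi.single_eq_of_ne hmn.symm]
    have hV0 : ∀ n, n ≠ m ∧ n ≠ n₀ → V n = 0 := fun n hn => by
      simp [V, Pi.single_eq_of_ne hn.1, Pi.single_eq_of_ne hn.2]
    have hV : ∀ n, V n ∈ Linfty P := fun n => by
      by_cases h1 : n = m
      · rw [h1, hVm]; exact hX
      · by_cases h2 : n = n₀
        · rw [h2, hVn₀]; exact smul_mem_Linfty _ hX
        · rw [hV0 n ⟨h1, h2⟩]; exact zero_mem_Linfty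
    obtain ⟨t, -, ht⟩ := exists_lt_sum_integral_add_smul (V := V) hWi
      (fun n => integrable_of_mem_Linfty _ (hV n)) (by
        rw [Fintype.sum_eq_add m n₀ hmn fun n hn => by rw [hV0 n hn, integral_zero_coeFn],
          hVm, hVn₀, integral_smul_coeFn]
        linarith) c
    refine ⟨_, ⟨0, fun n => t • V n, fun n => (A n).zero_mem, fun n => Submodule.zero_mem _,
      fun n => smul_mem_Linfty t (hV n), ?_, fun n => by simp⟩, ht⟩
    rw [← Finset.smul_sum, Fintype.sum_eq_add m n₀ hmn hV0, hVm, hVn₀]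
    simp

/-- Each infimum `u n (Z n)` is attained at some `Q n` by compactness; these separately chosen
minimisers form an admissible tuple for the minimax bound. -/
theorem exists_attainable_le_sum [IsProbabilityMeasure P] {N : ℕ} (hN : 0 < N)
    {u : Fin N → (Ω →ₘ[P] ℝ) → EReal} {D : Fin N → Set (AbsContProb P)}
    (hu : ∀ n, IsCoherentUtilityOn univ (u n) (D n)) (hD : ∀ n, IsWeaklyCompact (D n))
    (A : Fin N → PointedCone ℝ (Ω →ₘ[P] ℝ))
    (hA : ∀ n, IsConsistent (D n) (A n : Set (Ω →ₘ[P] ℝ))) {W : Fin N → (Ω →ₘ[P] ℝ)}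
    (hW : ∀ n, W n ∈ continuousExpectation (D n)) {c : ℝ}
    (hc : (c : EReal) < ⨅ Q ∈ ⋂ n, D n ∩ riskNeutral (A n : Set (Ω →ₘ[P] ℝ)),
      expect Q (∑ n, W n)) :
    ∃ Z ∈ attainable D A W, (c : EReal) ≤ ∑ n, u n (Z n) := by
  obtain ⟨Z, hZ, hle⟩ := exists_attainable_forall_le hN (fun n => (hu n).1.1)
    (fun n => (hD n).isCompact) (fun n => (hu n).mixtureClosed) A hA hW hc
  choose Q hQ hQe using fun n => exists_expect_eq_iInf (hu n).1.1 (hD n).isCompact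
    (apply_mem_continuousExpectation_of_mem_attainable hW hZ n)
  refine ⟨Z, hZ, ?_⟩
  have : ∀ n, u n (Z n) = ((∫ ω, Z n ω ∂((Q n).1 : Measure Ω) : ℝ) : EReal) := fun n => by
    rw [(hu n).1.2 _ (mem_univ _), hQe]
  simp only [this]
  rw [← coe_finset_sum_real]
  exact EReal.coe_le_coe_iff.2 (hle Q hQ)

theorem isConsistent_bot (D : Set (AbsContProb P)) :
    IsConsistent D ((⊥ : PointedCone ℝ (Ω →ₘ[P] ℝ)) : Set (Ω →ₘ[P] ℝ)) := by
  refine ⟨_, fun X hX => ⟨hX, mem_strongL1_of_mem_Linfty D ?_⟩, rfl⟩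
  obtain rfl : X = 0 := by simpa using hX
  exact zero_mem_Linfty

theorem riskNeutral_bot :
    riskNeutral ((⊥ : PointedCone ℝ (Ω →ₘ[P] ℝ)) : Set (Ω →ₘ[P] ℝ)) = univ := by
  refine eq_univ_of_forall fun Q X hX => ?_
  obtain rfl : X = 0 := by simpa using hX
  rw [expect_eq_integral (integrable_zero_coeFn Q), integral_zero_coeFn, EReal.coe_zero]

/-! ### The two dual formulas -/

theorem maxOverallUtility_eq [IsProbabilityMeasure P] {N : ℕ} (hN : 0 < N)
    {u : Fin N → (Ω →ₘ[P] ℝ) → EReal} {D : Fin N → Set (AbsContProb P)}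
    (hu : ∀ n, IsCoherentUtilityOn univ (u n) (D n)) (hD : ∀ n, IsWeaklyCompact (D n))
    (A : Fin N → PointedCone ℝ (Ω →ₘ[P] ℝ))
    (hA : ∀ n, IsConsistent (D n) (A n : Set (Ω →ₘ[P] ℝ))) {W : Fin N → (Ω →ₘ[P] ℝ)}
    (hW : ∀ n, W n ∈ strongL1 (D n)) :
    maxOverallUtility u D (fun n => (A n : Set (Ω →ₘ[P] ℝ))) W =
      ⨅ Q ∈ ⋂ n, D n ∩ riskNeutral (A n : Set (Ω →ₘ[P] ℝ)), expect Q (∑ n, W n) := by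
  refine le_antisymm (iSup₂_le fun X hX => iSup₂_le fun Y hY => iSup_le fun hY0 =>
    le_iInf₂ fun Q hQ => ?_) (EReal.ge_of_forall_gt_iff_ge.1 fun c hc => ?_)
  · have hQ' := mem_iInter.1 hQ
    have hWi : ∀ n, Integrable (W n) (Q.1 : Measure Ω) := fun n =>
      integrable_of_mem_strongL1 (hW n) (hQ' n).1
    have hYi : ∀ n, Integrable (Y n) (Q.1 : Measure Ω) := fun n =>
      integrable_of_mem_strongL1 (hY n) (mem_iInter.2 fun m => (hQ' m).1)
    have hWY : ∀ n, Integrable ⇑(W n + Y n) (Q.1 : Measure Ω) := fun n =>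
      integrable_add (hWi n) (hYi n)
    calc ∑ n, u n (W n + X n + Y n)
        ≤ ∑ n, ((∫ ω, (W n + Y n) ω ∂(Q.1 : Measure Ω) : ℝ) : EReal) :=
          Finset.sum_le_sum fun n _ => by
            rw [add_right_comm]
            exact ((hu n).le_expect (hQ' n).1 (mem_univ _)).trans
              (expect_add_le (hWY n) ((hQ' n).2 _ (hX n)))
      _ = expect Q (∑ n, (W n + Y n)) := by rw [← coe_finset_sum_real, expect_sum _ hWY]
      _ = expect Q (∑ n, W n) := by rw [Finset.sum_add_distrib, hY0, add_zero]
  -- Only real `c` below the infimum need be reached; when no admissible measure exists, these are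
  -- all real numbers and the supremum is `⊤`.
  · obtain ⟨Z, ⟨X, Y, hXA, -, hY, hY0, hZ⟩, hle⟩ := exists_attainable_le_sum hN hu hD A hA
      (fun n => mem_continuousExpectation_of_mem_strongL1 (hW n)) hc
    simp only [hZ] at hle
    exact le_iSup₂_of_le X hXA (le_iSup₂_of_le Y
      (fun n => mem_strongL1_of_mem_Linfty _ (hY n)) (le_iSup_of_le hY0 hle))

theorem supConvolution_eq [IsProbabilityMeasure P] {N : ℕ} (hN : 0 < N)
    {u : Fin N → (Ω →ₘ[P] ℝ) → EReal} {D : Fin N → Set (AbsContProb P)}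
    (hu : ∀ n, IsCoherentUtilityOn univ (u n) (D n)) (hD : ∀ n, IsWeaklyCompact (D n))
    {X : Ω →ₘ[P] ℝ} (hX : X ∈ Linfty P) :
    supConvolution u X = ⨅ Q ∈ ⋂ n, D n, expect Q X := by
  classical
  refine le_antisymm (iSup₂_le fun Z hZ => iSup_le fun hZX => le_iInf₂ fun Q hQ => ?_)
    (EReal.ge_of_forall_gt_iff_ge.1 fun c hc => ?_)
  · rw [← hZX, expect_sum _ fun n => integrable_of_mem_Linfty Q (hZ n), coe_finset_sum_real]
    refine Finset.sum_le_sum fun n _ => ?_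
    rw [← expect_eq_integral (integrable_of_mem_Linfty Q (hZ n))]
    exact (hu n).le_expect (mem_iInter.1 hQ n) (mem_univ _)
  -- The first agent holds all of `X`; with zero cones, attainable tuples are exactly its bounded
  -- reallocations.
  · let W : Fin N → (Ω →ₘ[P] ℝ) := Pi.single ⟨0, hN⟩ X
    have hWX : ∑ n, W n = X := by simp [W]
    have hW : ∀ n, W n ∈ Linfty P := fun n => by
      by_cases hn : n = ⟨0, hN⟩
      · rw [hn]; simpa [W] using hX
      · simp only [W]; rw [Pi.single_eq_of_ne hn]; exact zero_mem_Linfty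
    obtain ⟨Z, ⟨X', Y, hXA, -, hY, hY0, hZ⟩, hle⟩ := exists_attainable_le_sum hN hu hD (fun _ => ⊥)
      (fun n => isConsistent_bot (D n))
      (fun n => mem_continuousExpectation_of_mem_Linfty _ (hW n)) (c := c)
      (by simpa only [riskNeutral_bot, inter_univ, hWX] using hc)
    have hZ' : ∀ n, Z n = W n + Y n := fun n => by
      rw [hZ, show X' n = 0 by simpa using hXA n, add_zero]
    refine le_iSup₂_of_le Z (fun n => ?_) (le_iSup_of_le ?_ hle)
    · rw [hZ']; exact add_mem_Linfty (hW n) (hY n)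
    · simp only [hZ', Finset.sum_add_distrib, hY0, hWX, add_zero]

/-! ### Maximality of the determining set -/

theorem mixtureClosed_singleton (Q : AbsContProb P) : MixtureClosed {Q} := by
  rintro _ rfl _ rfl a b ha hb hab
  refine Subtype.ext (Subtype.ext ?_)
  change ENNReal.ofReal a • _ + ENNReal.ofReal b • _ = _
  rw [← add_smul, ← ENNReal.ofReal_add ha.le hb.le, hab, ENNReal.ofReal_one, one_smul]
  rfl

/-- A weakly compact mixture-closed set of measures is separated from the measures outside it by
bounded random variables. -/
theorem mem_of_forall_iInf_le [IsProbabilityMeasure P] {D : Set (AbsContProb P)}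
    (hne : D.Nonempty) (hD : IsCompact D) (hmix : MixtureClosed D) {Q : AbsContProb P}
    (hQ : ∀ X ∈ Linfty P, ⨅ R ∈ D, expect R X ≤ expect Q X) : Q ∈ D := by
  by_contra hQD
  -- These two sets are disjoint, so the dual infimum is `⊤` and `c = 1` is allowed. The resulting
  -- transfer `(Y 0, -Y 0)` satisfies `E_R (Y 0) - E_Q (Y 0) ≥ 1` for all `R ∈ D`, contradicting
  -- `hQ` at a minimiser `R`.
  let E : Fin 2 → Set (AbsContProb P) := ![D, {Q}]
  obtain ⟨Z, ⟨X, Y, hXA, -, hY, hY0, hZ⟩, hle⟩ := exists_attainable_forall_le (D := E) (W := 0)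
    (c := 1) two_pos (Fin.forall_fin_two.2 ⟨hne, singleton_nonempty Q⟩)
    (Fin.forall_fin_two.2 ⟨hD, isCompact_singleton⟩)
    (Fin.forall_fin_two.2 ⟨hmix, mixtureClosed_singleton Q⟩) (fun _ => ⊥)
    (fun n => isConsistent_bot (E n)) (fun n => Submodule.zero_mem _) (by
      have hE : ⋂ n, E n ∩ riskNeutral ((⊥ : PointedCone ℝ (Ω →ₘ[P] ℝ)) : Set (Ω →ₘ[P] ℝ)) = ∅ := by
        refine eq_empty_of_forall_notMem fun R hR => hQD ?_
        have hR' := mem_iInter.1 hR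
        have h1 : R = Q := (hR' 1).1
        exact h1 ▸ (hR' 0).1
      rw [hE]
      simpa using EReal.coe_lt_top 1)
  have hZY : ∀ n, Z n = Y n := fun n => by
    rw [hZ, show X n = 0 by simpa using hXA n, Pi.zero_apply, zero_add, zero_add]
  have hY1 : Y 1 = (-1 : ℝ) • Y 0 := by
    rw [Fin.sum_univ_two] at hY0
    rw [neg_one_smul]
    exact eq_neg_of_add_eq_zero_right hY0
  obtain ⟨R, hR, hReq⟩ := exists_expect_eq_iInf hne hD
    (mem_continuousExpectation_of_mem_Linfty D (hY 0))
  have h1 := hQ _ (hY 0)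
  rw [hReq, expect_eq_integral (integrable_of_mem_Linfty Q (hY 0)), EReal.coe_le_coe_iff] at h1
  have h2 := hle ![R, Q] (Fin.forall_fin_two.2 ⟨hR, rfl⟩)
  simp only [hZY, Fin.sum_univ_two, Matrix.cons_val_zero, Matrix.cons_val_one, hY1,
    integral_smul_coeFn] at h2
  linarith

/-- Any `Q` in a representing set dominates the infimum over the intersection, hence the
larger-domain infimum over each `D n`; separation by bounded variables puts it in `D n`. -/
theorem isCoherentUtilityOn_supConvolution [IsProbabilityMeasure P] {N : ℕ} (hN : 0 < N)
    {u : Fin N → (Ω →ₘ[P] ℝ) → EReal} {D : Fin N → Set (AbsContProb P)}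
    (hu : ∀ n, IsCoherentUtilityOn univ (u n) (D n)) (hD : ∀ n, IsWeaklyCompact (D n))
    (hne : (⋂ n, D n).Nonempty) :
    IsCoherentUtilityOn (Linfty P) (supConvolution u) (⋂ n, D n) := by
  refine ⟨⟨hne, fun X hX => supConvolution_eq hN hu hD hX⟩, ?_⟩
  rintro D' ⟨-, hD'⟩ Q hQ
  refine mem_iInter.2 fun n => mem_of_forall_iInf_le (hu n).1.1 (hD n).isCompact
    (hu n).mixtureClosed fun X hX => ?_
  calc ⨅ R ∈ D n, expect R X ≤ ⨅ R ∈ ⋂ m, D m, expect R X :=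
        biInf_mono fun R hR => mem_iInter.1 hR n
    _ = supConvolution u X := (supConvolution_eq hN hu hD hX).symm
    _ ≤ expect Q X := (hD' X hX).trans_le (iInf₂_le Q hQ)

end CoherentUtility

theorem mainTheorem4 {Ω : Type*} [MeasurableSpace Ω] (P : Measure Ω) [IsProbabilityMeasure P]
    {N : ℕ} (hN : 0 < N)
    (u : Fin N → (Ω →ₘ[P] ℝ) → EReal) (D : Fin N → Set (CoherentUtility.AbsContProb P))
    (hu : ∀ n, CoherentUtility.IsCoherentUtilityOn univ (u n) (D n))
    (hD : ∀ n, CoherentUtility.IsWeaklyCompact (D n))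
    (A : Fin N → PointedCone ℝ (Ω →ₘ[P] ℝ))
    (hA : ∀ n, CoherentUtility.IsConsistent (D n) (A n : Set (Ω →ₘ[P] ℝ)))
    (W : Fin N → (Ω →ₘ[P] ℝ)) (hW : ∀ n, W n ∈ CoherentUtility.strongL1 (D n)) :
    CoherentUtility.maxOverallUtility u D (fun n => (A n : Set (Ω →ₘ[P] ℝ))) W =
        ⨅ Q ∈ ⋂ n, D n ∩ CoherentUtility.riskNeutral (A n : Set (Ω →ₘ[P] ℝ)),
          CoherentUtility.expect Q (∑ n, W n) ∧
    (∀ X ∈ CoherentUtility.Linfty P,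
      CoherentUtility.supConvolution u X = ⨅ Q ∈ ⋂ n, D n, CoherentUtility.expect Q X) ∧
    ((⋂ n, D n).Nonempty → CoherentUtility.IsCoherentUtilityOn (CoherentUtility.Linfty P)
      (CoherentUtility.supConvolution u) (⋂ n, D n)) ∧
    ((⋂ n, D n) = ∅ → ∀ X ∈ CoherentUtility.Linfty P,
      CoherentUtility.supConvolution u X = ⊤) :=
  ⟨CoherentUtility.maxOverallUtility_eq hN hu hD A hA hW,
    fun _ hX => CoherentUtility.supConvolution_eq hN hu hD hX,
    fun hne => CoherentUtility.isCoherentUtilityOn_supConvolution hN hu hD hne,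
    fun h X hX => by simp [CoherentUtility.supConvolution_eq hN hu hD hX, h]⟩
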